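/- Let $\mathbb K=\mathbb R$ or $\mathbb C$; all Banach spaces are over $\mathbb K$, $e_j$ denotes the $j$-th unit vector, and $c_{00}(E)$, $\ell_\infty(E)$ are the spaces of eventually null, respectively bounded, $E$-valued sequences. A *sequence class* is a rule $X$ that assigns to each Banach space $E$ a Banach space $X(E)$ of $E$-valued sequences such that $c_{00}(E)\subseteq X(E)\subseteq \ell_\infty(E)$, $\|\cdot\|_{\infty}\le\|\cdot\|_{X(E)}$ on $X(E)$, and $\|e_j\|_{X(\mathbb K)}=1$ for every $j$. A *scalar sequence space* is a Banach space $\lambda\subseteq\mathbb K^{\mathbb N}$ (with coordinatewise operations) such that $c_{00}\subseteq\lambda\subseteq\ell_\infty$, $\|\cdot\|_\infty\le\|\cdot\|_\lambda$ on $\lambda$, $(e_j)_{j=1}^\infty$ is a Schauder basis of $\lambda$, and $\|e_j\|_\lambda=1$ for every $j$. A *Banach operator ideal* $\mathcal I$ assigns to every pair of Banach spaces $E,F$ a linear subspace $\mathcal I(E,F)$ of the space $\mathcal L(E,F)$ of bounded operators, containing the finite rank operators, and a complete norm $\|\cdot\|_{\mathcal I}$ on it, such that $\|\mathrm{id}_{\mathbb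 K}\|_{\mathcal I}=1$ and, whenever $R\in\mathcal L(E_0,E)$, $S\in\mathcal I(E,F)$ and $T\in\mathcal L(F,F_0)$, one has $T S R\in\mathcal I(E_0,F_0)$ and $\|TSR\|_{\mathcal I}\le\|T\|\,\|S\|_{\mathcal I}\,\|R\|$. A sequence class $X$ is *ideal-representable* if there are a Banach operator ideal $\mathcal I$ and a scalar sequence space $\lambda$ such that for each Banach space $E$ the map $$\Psi\colon \mathcal I(\lambda,E)\to X(E),\qquad \Psi(u)=(u(e_j))_{j=1}^\infty,$$ is a well defined isometric isomorphism (onto $X(E)$). **Proposition.** For $1<p<\infty$, the sequence class $\ell_p(\cdot)$, which assigns to each Banach space $E$ the space $\ell_p(E)$ of absolutely $p$-summable $E$-valued sequences with the norm $\|(x_j)_{j=1}^\infty\|_p=\big(\sum_{j=1}^\infty\|x_j\|^p\big)^{1/p}$, is not ideal-representable. -/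

import Mathlib

open Filter Topology

universe u

/-- `N` restricted to the linear subspace `V` is a norm for which `V` is a Banach space.
The values of `N` outside `V` play no role. -/
structure IsBanachNorm {𝕜 : Type*} {M : Type*} [RCLike 𝕜] [AddCommGroup M] [Module 𝕜 M]
    (V : Submodule 𝕜 M) (N : M → ℝ) : Prop where
  nonneg : ∀ x ∈ V, 0 ≤ N x
  eq_zero : ∀ x ∈ V, N x = 0 → x = 0
  smul : ∀ (c : 𝕜), ∀ x ∈ V, N (c • x) = ‖c‖ * N x
  add_le : ∀ x ∈ V, ∀ y ∈ V, N (x + y) ≤ N x + N y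
  complete : ∀ s : ℕ → M, (∀ n, s n ∈ V) →
    (∀ ε > 0, ∃ n₀, ∀ m ≥ n₀, ∀ n ≥ n₀, N (s m - s n) < ε) →
    ∃ x ∈ V, Tendsto (fun n => N (s n - x)) atTop (𝓝 0)

/-- A sequence class: a rule that assigns to every Banach space `E` a Banach space `X(E)` of
`E`-valued sequences with `c₀₀(E) ⊆ X(E)`, with `X(E) ⊆ ℓ_∞(E)` and `‖·‖_∞ ≤ ‖·‖_{X(E)}`, and with
`‖e_j‖_{X(𝕜)} = 1` for all `j`. -/
structure SequenceClass (𝕜 : Type u) [RCLike 𝕜] where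
  /-- the space `X(E)` -/
  space : ∀ (E : Type u) [NormedAddCommGroup E] [NormedSpace 𝕜 E] [CompleteSpace E],
    Submodule 𝕜 (ℕ → E)
  /-- the norm of `X(E)`; only its values on `X(E)` matter -/
  nrm : ∀ (E : Type u) [NormedAddCommGroup E] [NormedSpace 𝕜 E] [CompleteSpace E],
    (ℕ → E) → ℝ
  isBanachNorm : ∀ (E : Type u) [NormedAddCommGroup E] [NormedSpace 𝕜 E] [CompleteSpace E],
    IsBanachNorm (space E) (nrm E)
  mem_of_finite_support : ∀ (E : Type u) [NormedAddCommGroup E] [NormedSpace 𝕜 E]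
    [CompleteSpace E] (x : ℕ → E), {j | x j ≠ 0}.Finite → x ∈ space E
  norm_apply_le : ∀ (E : Type u) [NormedAddCommGroup E] [NormedSpace 𝕜 E] [CompleteSpace E],
    ∀ x ∈ space E, ∀ j, ‖x j‖ ≤ nrm E x
  nrm_single : ∀ j : ℕ, nrm 𝕜 (Pi.single j (1 : 𝕜)) = 1

/-- A Banach operator ideal: for all Banach spaces `E`, `F` a linear subspace `I(E, F)` of the
bounded operators from `E` to `F`, complete for its own norm, that contains the operators of finite
rank, with `‖id_𝕜‖_I = 1`, and with the ideal property
`‖T ∘ S ∘ R‖_I ≤ ‖T‖ ‖S‖_I ‖R‖`. -/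
structure BanachOperatorIdeal (𝕜 : Type u) [RCLike 𝕜] where
  /-- the component `I(E, F)` -/
  comp : ∀ (E F : Type u) [NormedAddCommGroup E] [NormedSpace 𝕜 E] [CompleteSpace E]
    [NormedAddCommGroup F] [NormedSpace 𝕜 F] [CompleteSpace F], Submodule 𝕜 (E →L[𝕜] F)
  /-- the ideal norm on `I(E, F)`; only its values on `I(E, F)` matter -/
  nrm : ∀ (E F : Type u) [NormedAddCommGroup E] [NormedSpace 𝕜 E] [CompleteSpace E]
    [NormedAddCommGroup F] [NormedSpace 𝕜 F] [CompleteSpace F], (E →L[𝕜] F) → ℝ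
  isBanachNorm : ∀ (E F : Type u) [NormedAddCommGroup E] [NormedSpace 𝕜 E] [CompleteSpace E]
    [NormedAddCommGroup F] [NormedSpace 𝕜 F] [CompleteSpace F],
    IsBanachNorm (comp E F) (nrm E F)
  mem_of_finiteRank : ∀ (E F : Type u) [NormedAddCommGroup E] [NormedSpace 𝕜 E]
    [CompleteSpace E] [NormedAddCommGroup F] [NormedSpace 𝕜 F] [CompleteSpace F]
    (S : E →L[𝕜] F), FiniteDimensional 𝕜 (LinearMap.range (S : E →ₗ[𝕜] F)) → S ∈ comp E F
  nrm_id : nrm 𝕜 𝕜 (ContinuousLinearMap.id 𝕜 𝕜) = 1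
  comp_mem : ∀ (E₀ E F F₀ : Type u)
    [NormedAddCommGroup E₀] [NormedSpace 𝕜 E₀] [CompleteSpace E₀]
    [NormedAddCommGroup E] [NormedSpace 𝕜 E] [CompleteSpace E]
    [NormedAddCommGroup F] [NormedSpace 𝕜 F] [CompleteSpace F]
    [NormedAddCommGroup F₀] [NormedSpace 𝕜 F₀] [CompleteSpace F₀]
    (T : F →L[𝕜] F₀) (S : E →L[𝕜] F) (R : E₀ →L[𝕜] E), S ∈ comp E F →
    (T.comp S).comp R ∈ comp E₀ F₀
  nrm_comp_le : ∀ (E₀ E F F₀ : Type u)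
    [NormedAddCommGroup E₀] [NormedSpace 𝕜 E₀] [CompleteSpace E₀]
    [NormedAddCommGroup E] [NormedSpace 𝕜 E] [CompleteSpace E]
    [NormedAddCommGroup F] [NormedSpace 𝕜 F] [CompleteSpace F]
    [NormedAddCommGroup F₀] [NormedSpace 𝕜 F₀] [CompleteSpace F₀]
    (T : F →L[𝕜] F₀) (S : E →L[𝕜] F) (R : E₀ →L[𝕜] E), S ∈ comp E F →
    nrm E₀ F₀ ((T.comp S).comp R) ≤ ‖T‖ * nrm E F S * ‖R‖

/-- A Banach space `Λ ⊆ 𝕜^ℕ` of scalar sequences with `c₀₀ ⊆ Λ ⊆ ℓ_∞` and `‖·‖_∞ ≤ ‖·‖_Λ`, in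
which all unit vectors have norm one. -/
structure BanachSequenceSpace (𝕜 : Type u) [RCLike 𝕜] where
  /-- the underlying linear space of scalar sequences -/
  space : Submodule 𝕜 (ℕ → 𝕜)
  /-- the norm; only its values on `space` matter -/
  nrm : (ℕ → 𝕜) → ℝ
  isBanachNorm : IsBanachNorm space nrm
  mem_of_finite_support : ∀ x : ℕ → 𝕜, {j | x j ≠ 0}.Finite → x ∈ space
  norm_apply_le : ∀ x ∈ space, ∀ j, ‖x j‖ ≤ nrm x
  nrm_single : ∀ j : ℕ, nrm (Pi.single j (1 : 𝕜)) = 1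

namespace BanachSequenceSpace

variable {𝕜 : Type u} [RCLike 𝕜] (Λ : BanachSequenceSpace 𝕜)

/-- The sequences of `Λ` as a type of its own, which carries the norm of `Λ` (and not the topology
of coordinatewise convergence). -/
def Carrier : Type u := Λ.space

instance : AddCommGroup Λ.Carrier := inferInstanceAs (AddCommGroup Λ.space)

instance : Module 𝕜 Λ.Carrier := inferInstanceAs (Module 𝕜 Λ.space)

instance : Norm Λ.Carrier := ⟨fun x => Λ.nrm x.1⟩

theorem core : NormedSpace.Core 𝕜 Λ.Carrier where
  norm_nonneg x := Λ.isBanachNorm.nonneg x.1 x.2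
  norm_smul c x := Λ.isBanachNorm.smul c x.1 x.2
  norm_triangle x y := Λ.isBanachNorm.add_le x.1 x.2 y.1 y.2
  norm_eq_zero_iff x := by
    constructor
    · intro h
      exact Subtype.ext (Λ.isBanachNorm.eq_zero x.1 x.2 h)
    · rintro rfl
      have h := Λ.isBanachNorm.smul 0 0 Λ.space.zero_mem
      rw [smul_zero, norm_zero, zero_mul] at h
      exact h

noncomputable instance : NormedAddCommGroup Λ.Carrier := NormedAddCommGroup.ofCore Λ.core

noncomputable instance : NormedSpace 𝕜 Λ.Carrier := NormedSpace.ofCore Λ.core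

instance : CompleteSpace Λ.Carrier := by
  refine Metric.complete_of_cauchySeq_tendsto fun s hs => ?_
  rw [Metric.cauchySeq_iff] at hs
  obtain ⟨x, hx, h⟩ := Λ.isBanachNorm.complete (fun n => (s n).1) (fun n => (s n).2)
    (fun ε hε => by
      obtain ⟨n₀, h⟩ := hs ε hε
      refine ⟨n₀, fun m hm n hn => ?_⟩
      have := h m hm n hn
      rw [dist_eq_norm] at this
      exact this)
  exact ⟨show Λ.Carrier from ⟨x, hx⟩, tendsto_iff_norm_sub_tendsto_zero.2 h⟩

/-- The unit vector `e_j` as an element of `Λ`. -/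
def e (j : ℕ) : Λ.Carrier :=
  (⟨Pi.single j (1 : 𝕜), Λ.mem_of_finite_support _ ((Set.finite_singleton j).subset (by
    intro i hi
    by_contra h
    exact hi (Pi.single_eq_of_ne h 1)))⟩ : Λ.space)

end BanachSequenceSpace

/-- A scalar sequence space: a Banach space `Λ ⊆ 𝕜^ℕ` with `c₀₀ ⊆ Λ ⊆ ℓ_∞` and
`‖·‖_∞ ≤ ‖·‖_Λ`, in which the unit vectors have norm one and form a Schauder basis. -/
structure ScalarSequenceSpace (𝕜 : Type u) [RCLike 𝕜] extends BanachSequenceSpace 𝕜 where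
  schauder : ∃ b : SchauderBasis 𝕜 toBanachSequenceSpace.Carrier,
    ∀ j, b.basis j = toBanachSequenceSpace.e j

/-- `X` is represented by `I` and `Λ`: for every Banach space `E`, the map `u ↦ (u(e_j))_j` is a
well defined isometric isomorphism from `I(Λ, E)` onto `X(E)`. (Its linearity is evident.) -/
def SequenceClass.RepresentedBy {𝕜 : Type u} [RCLike 𝕜] (X : SequenceClass 𝕜)
    (I : BanachOperatorIdeal 𝕜) (Λ : ScalarSequenceSpace 𝕜) : Prop :=
  ∀ (E : Type u) [NormedAddCommGroup E] [NormedSpace 𝕜 E] [CompleteSpace E],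
    Set.BijOn (fun (u : Λ.Carrier →L[𝕜] E) (j : ℕ) => u (Λ.e j))
      (I.comp Λ.Carrier E) (X.space E) ∧
    ∀ u ∈ I.comp Λ.Carrier E, X.nrm E (fun j => u (Λ.e j)) = I.nrm Λ.Carrier E u

/-- `X` is ideal-representable: it is represented by some Banach operator ideal and some scalar
sequence space. -/
def SequenceClass.IdealRepresentable {𝕜 : Type u} [RCLike 𝕜] (X : SequenceClass 𝕜) : Prop :=
  ∃ (I : BanachOperatorIdeal 𝕜) (Λ : ScalarSequenceSpace 𝕜), X.RepresentedBy I Λ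

section AbsolutelySummable

variable (𝕜 : Type u) [RCLike 𝕜] (p : ℝ)

/-- The linear space `ℓ_p(E)` of absolutely `p`-summable sequences in `E`. -/
def absSummable (hp : 1 ≤ p) (E : Type u) [NormedAddCommGroup E] [NormedSpace 𝕜 E] :
    Submodule 𝕜 (ℕ → E) where
  carrier := {x | Summable fun j => ‖x j‖ ^ p}
  zero_mem' := by
    have h : p ≠ 0 := by linarith
    simp [Real.zero_rpow h, summable_zero]
  add_mem' := by
    intro x y hx hy
    have h0 : 0 < (ENNReal.ofReal p).toReal := by
      rw [ENNReal.toReal_ofReal (by linarith)]; linarith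
    have key : ∀ z : ℕ → E, Memℓp z (ENNReal.ofReal p) ↔ Summable fun j => ‖z j‖ ^ p := by
      intro z
      rw [memℓp_gen_iff h0, ENNReal.toReal_ofReal (by linarith)]
    exact (key _).1 (((key x).2 hx).add ((key y).2 hy))
  smul_mem' := by
    intro c x hx
    have : (fun j => ‖(c • x) j‖ ^ p) = fun j => ‖c‖ ^ p * ‖x j‖ ^ p := by
      funext j
      rw [Pi.smul_apply, norm_smul, Real.mul_rpow (norm_nonneg _) (norm_nonneg _)]
    change Summable fun j => ‖(c • x) j‖ ^ p
    rw [this]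
    exact Summable.mul_left _ hx

/-- The norm `‖x‖_p = (∑_j ‖x_j‖^p)^{1/p}`. -/
noncomputable def absSummableNorm (E : Type u) [NormedAddCommGroup E] (x : ℕ → E) : ℝ :=
  (∑' j, ‖x j‖ ^ p) ^ (1 / p)

variable {p} in
theorem mem_absSummable_iff (hp : 1 ≤ p) {E : Type u} [NormedAddCommGroup E] [NormedSpace 𝕜 E]
    (x : ℕ → E) : x ∈ absSummable 𝕜 p hp E ↔ Memℓp x (ENNReal.ofReal p) := by
  have h0 : 0 < (ENNReal.ofReal p).toReal := by
    rw [ENNReal.toReal_ofReal (by linarith)]; linarith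
  rw [memℓp_gen_iff h0, ENNReal.toReal_ofReal (by linarith)]
  exact Iff.rfl

variable {p} in
theorem absSummableNorm_eq (hp : 1 ≤ p) {E : Type u} [NormedAddCommGroup E]
    (x : lp (fun _ : ℕ => E) (ENNReal.ofReal p)) :
    absSummableNorm p E (fun j => x j) = ‖x‖ := by
  have h0 : 0 < (ENNReal.ofReal p).toReal := by
    rw [ENNReal.toReal_ofReal (by linarith)]; linarith
  rw [lp.norm_eq_tsum_rpow h0, ENNReal.toReal_ofReal (by linarith)]
  rfl

variable {p} in
theorem absSummable_isBanachNorm (hp : 1 ≤ p) (E : Type u) [NormedAddCommGroup E]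
    [NormedSpace 𝕜 E] [CompleteSpace E] :
    IsBanachNorm (absSummable 𝕜 p hp E) (absSummableNorm p E) := by
  have : Fact (1 ≤ ENNReal.ofReal p) := ⟨by simpa using hp⟩
  have lift : ∀ x ∈ absSummable 𝕜 p hp E, ∃ z : lp (fun _ : ℕ => E) (ENNReal.ofReal p),
      (fun j => z j) = x := fun x hx => ⟨⟨x, (mem_absSummable_iff 𝕜 hp x).1 hx⟩, rfl⟩
  refine ⟨?_, ?_, ?_, ?_, ?_⟩
  · intro x hx
    obtain ⟨z, rfl⟩ := lift x hx
    rw [absSummableNorm_eq hp]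
    exact norm_nonneg z
  · intro x hx h
    obtain ⟨z, rfl⟩ := lift x hx
    rw [absSummableNorm_eq hp, norm_eq_zero] at h
    rw [h]
    rfl
  · intro c x hx
    obtain ⟨z, rfl⟩ := lift x hx
    rw [absSummableNorm_eq hp, ← norm_smul, ← absSummableNorm_eq hp]
    rfl
  · intro x hx y hy
    obtain ⟨z, rfl⟩ := lift x hx
    obtain ⟨w, rfl⟩ := lift y hy
    rw [absSummableNorm_eq hp, absSummableNorm_eq hp]
    refine le_trans (le_of_eq ?_) (norm_add_le z w)
    rw [← absSummableNorm_eq hp]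
    rfl
  · intro s hs hc
    choose z hz using fun n => lift (s n) (hs n)
    have hsub : ∀ (n : ℕ) (w : lp (fun _ : ℕ => E) (ENNReal.ofReal p)),
        absSummableNorm p E (s n - fun j => w j) = ‖z n - w‖ := by
      intro n w
      rw [← absSummableNorm_eq hp, ← hz n]
      rfl
    have hcz : CauchySeq z := by
      rw [Metric.cauchySeq_iff]
      intro ε hε
      obtain ⟨n₀, h⟩ := hc ε hε
      refine ⟨n₀, fun m hm n hn => ?_⟩
      have := h m hm n hn
      rw [← hz n, hsub] at this
      rwa [dist_eq_norm]
    obtain ⟨w, hw⟩ := cauchySeq_tendsto_of_complete hcz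
    refine ⟨fun j => w j, (mem_absSummable_iff 𝕜 hp _).2 w.2, ?_⟩
    simp only [hsub]
    exact tendsto_iff_norm_sub_tendsto_zero.1 hw

variable {p} in
/-- The sequence class `ℓ_p(·)` of absolutely `p`-summable sequences, for `1 ≤ p < ∞`. -/
noncomputable def absSummableClass (hp : 1 ≤ p) : SequenceClass 𝕜 where
  space E := absSummable 𝕜 p hp E
  nrm E := absSummableNorm p E
  isBanachNorm E := absSummable_isBanachNorm 𝕜 hp E
  mem_of_finite_support E _ _ _ x hx := by
    have h : p ≠ 0 := by linarith
    change Summable fun j => ‖x j‖ ^ p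
    refine summable_of_hasFiniteSupport (hx.subset ?_)
    intro j hj h0
    exact hj (by simp [h0, Real.zero_rpow h])
  norm_apply_le E _ _ _ x hx j := by
    have h : 0 < p := by linarith
    have h1 : ‖x j‖ ^ p ≤ ∑' i, ‖x i‖ ^ p :=
      Summable.le_tsum hx j fun i _ => Real.rpow_nonneg (norm_nonneg _) p
    calc ‖x j‖ = (‖x j‖ ^ p) ^ (1 / p) := by
          rw [← Real.rpow_mul (norm_nonneg _), mul_one_div_cancel h.ne', Real.rpow_one]
      _ ≤ _ := Real.rpow_le_rpow (Real.rpow_nonneg (norm_nonneg _) p) h1 (by positivity)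
  nrm_single j := by
    have h : p ≠ 0 := by linarith
    unfold absSummableNorm
    rw [tsum_eq_single j]
    · simp
    · intro i hi
      simp [Pi.single_eq_of_ne hi, Real.zero_rpow h]

end AbsolutelySummable

/-! Suppose `I` and `Λ` represent `ℓ_p(·)`, and compute the norm of one operator `B` on `Λ` in two
ways: `B e₀ = e₀ + e₁`, `B e₁ = e₀ - e₁`, `B e_j = 0` for `j ≥ 2`. With scalar values, the ideal
norm is the dual norm, so `Λ* = ℓ_p` isometrically. The adjoint of `B` then acts as `(a, b) ↦ (a +
b, a - b)` on two coordinates of `ℓ_p`, and Clarkson's inequalities give `‖B‖ < 2`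
(`norm_butterfly_le`). With values in the two-dimensional `ℓ_1`, the projection `P` onto the first
two coordinates has ideal norm `2^{1/p}`. Since `‖f₀ ± f₁‖ = 2` for the unit vectors of `ℓ_1`, `P ∘
B` has ideal norm `2 · 2^{1/p}`, and the ideal property forces `‖B‖ ≥ 2` (`two_le_norm_butterfly`).
-/

/-! ### Clarkson inequalities for scalars -/

section Clarkson

/-- A Clarkson inequality for exponents `1 < p ≤ 2`. -/
theorem rpow_norm_add_add_rpow_norm_sub_le_of_le_two {𝕜 : Type*} [RCLike 𝕜] {p : ℝ} (hp : 1 < p)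
    (hp2 : p ≤ 2) (a b : 𝕜) :
    ‖a + b‖ ^ p + ‖a - b‖ ^ p ≤ 2 * (‖a‖ ^ p + ‖b‖ ^ p) := by
  have hpar := parallelogram_law_with_norm ℝ a b
  have hpow : ∀ t : ℝ, 0 ≤ t → (t * t) ^ (p / 2) = t ^ p := fun t ht => by
    rw [← sq, ← Real.rpow_natCast_mul ht]
    congr 1
    push_cast
    ring
  -- Concavity of `t ↦ t^{p/2}` at the midpoint of `‖a ± b‖²`, which is `‖a‖² + ‖b‖²` by the
  -- parallelogram law; subadditivity of the same power then splits that sum.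
  have hconc := (Real.concaveOn_rpow (p := p / 2) (by linarith) (by linarith)).2
    (Set.mem_Ici.2 (mul_self_nonneg ‖a + b‖)) (Set.mem_Ici.2 (mul_self_nonneg ‖a - b‖))
    one_half_pos.le one_half_pos.le (add_halves 1)
  have hmid : (1 / 2 : ℝ) • (‖a + b‖ * ‖a + b‖) + (1 / 2 : ℝ) • (‖a - b‖ * ‖a - b‖)
      = ‖a‖ * ‖a‖ + ‖b‖ * ‖b‖ := by
    simp only [smul_eq_mul]
    linarith
  have hsub := Real.rpow_add_le_add_rpow (p := p / 2) (mul_self_nonneg ‖a‖) (mul_self_nonneg ‖b‖)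
    (by linarith) (by linarith)
  beta_reduce at hconc
  rw [hmid, hpow _ (norm_nonneg _), hpow _ (norm_nonneg _), smul_eq_mul, smul_eq_mul] at hconc
  rw [hpow _ (norm_nonneg _), hpow _ (norm_nonneg _)] at hsub
  linarith

/-- A Clarkson inequality for exponents `2 ≤ p`. -/
theorem rpow_norm_add_add_rpow_norm_sub_le_of_two_le {𝕜 : Type*} [RCLike 𝕜] {p : ℝ}
    (hp2 : 2 ≤ p) (a b : 𝕜) :
    ‖a + b‖ ^ p + ‖a - b‖ ^ p ≤ 2 ^ (p - 1) * (‖a‖ ^ p + ‖b‖ ^ p) := by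
  have hpar := parallelogram_law_with_norm ℝ a b
  have hpow : ∀ t : ℝ, 0 ≤ t → (t * t) ^ (p / 2) = t ^ p := fun t ht => by
    rw [← sq, ← Real.rpow_natCast_mul ht]
    congr 1
    push_cast
    ring
  -- For `p/2 ≥ 1` the power is superadditive and convex, so the two tools trade places.
  have hsup := Real.add_rpow_le_rpow_add (p := p / 2) (mul_self_nonneg ‖a + b‖)
    (mul_self_nonneg ‖a - b‖) (by linarith)
  have hconv := (convexOn_rpow (p := p / 2) (by linarith)).2
    (Set.mem_Ici.2 (mul_self_nonneg ‖a‖)) (Set.mem_Ici.2 (mul_self_nonneg ‖b‖))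
    one_half_pos.le one_half_pos.le (add_halves 1)
  have hmid : ‖a + b‖ * ‖a + b‖ + ‖a - b‖ * ‖a - b‖
      = 4 * ((1 / 2 : ℝ) • (‖a‖ * ‖a‖) + (1 / 2 : ℝ) • (‖b‖ * ‖b‖)) := by
    simp only [smul_eq_mul]
    linarith
  have h4 : (4 : ℝ) ^ (p / 2) = 2 * 2 ^ (p - 1) := by
    rw [show (4 : ℝ) = 2 * 2 by norm_num, hpow 2 (by norm_num), Real.rpow_sub_one (by norm_num)]
    ring
  rw [hmid, hpow _ (norm_nonneg _), hpow _ (norm_nonneg _),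
    Real.mul_rpow (by norm_num) (by positivity), h4] at hsup
  beta_reduce at hconv
  rw [hpow _ (norm_nonneg a), hpow _ (norm_nonneg b), smul_eq_mul (_ : ℝ) (_ ^ p),
    smul_eq_mul (_ : ℝ) (_ ^ p)] at hconv
  calc ‖a + b‖ ^ p + ‖a - b‖ ^ p ≤ _ := hsup
    _ ≤ 2 * 2 ^ (p - 1) * (1 / 2 * ‖a‖ ^ p + 1 / 2 * ‖b‖ ^ p) := by gcongr
    _ = _ := by ring

/-- For `1 < p < ∞` the map `(a, b) ↦ (a + b, a - b)` on the two-dimensional `ℓ_p` has norm less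
than `2`. -/
theorem exists_rpow_norm_add_add_rpow_norm_sub_le {𝕜 : Type*} [RCLike 𝕜] {p : ℝ} (hp : 1 < p) :
    ∃ C : ℝ, 0 ≤ C ∧ C < 2 ∧ ∀ a b : 𝕜,
      ‖a + b‖ ^ p + ‖a - b‖ ^ p ≤ C ^ p * (‖a‖ ^ p + ‖b‖ ^ p) := by
  have hp0 : 0 < p := by linarith
  -- The constants are the `p`-th roots of those in the two Clarkson inequalities; `2^{1/p} < 2` is
  -- what fails at `p = 1`.
  rcases le_total p 2 with h | h
  · refine ⟨2 ^ (1 / p), by positivity, ?_, fun a b => ?_⟩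
    · refine (Real.rpow_lt_rpow_of_exponent_lt one_lt_two ?_).trans_eq (Real.rpow_one 2)
      rw [div_lt_one hp0]
      exact hp
    · rw [← Real.rpow_mul (by norm_num), one_div_mul_cancel hp0.ne', Real.rpow_one]
      exact rpow_norm_add_add_rpow_norm_sub_le_of_le_two hp h a b
  · refine ⟨2 ^ ((p - 1) / p), by positivity, ?_, fun a b => ?_⟩
    · refine (Real.rpow_lt_rpow_of_exponent_lt one_lt_two ?_).trans_eq (Real.rpow_one 2)
      rw [div_lt_one hp0]
      linarith
    · rw [← Real.rpow_mul (by norm_num), div_mul_cancel₀ _ hp0.ne']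
      exact rpow_norm_add_add_rpow_norm_sub_le_of_two_le h a b

end Clarkson

/-! ### The `ℓ_p` norm and the first two coordinates -/

theorem absSummableNorm_eq_of_two_le {p : ℝ} (hp : 0 < p) {E : Type*} [NormedAddCommGroup E]
    (x : ℕ → E) (hx : ∀ j, 2 ≤ j → x j = 0) :
    absSummableNorm p E x = (‖x 0‖ ^ p + ‖x 1‖ ^ p) ^ (1 / p) := by
  unfold absSummableNorm
  rw [tsum_eq_sum (s := Finset.range 2), Finset.sum_range_succ, Finset.sum_range_one]
  intro j hj
  rw [hx j (not_lt.1 (Finset.mem_range.not.1 hj)), norm_zero, Real.zero_rpow hp.ne']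

theorem le_absSummableNorm {p : ℝ} (hp : 0 < p) {E : Type*} [NormedAddCommGroup E]
    (x : ℕ → E) (hx : Summable fun j => ‖x j‖ ^ p) :
    (‖x 0‖ ^ p + ‖x 1‖ ^ p) ^ (1 / p) ≤ absSummableNorm p E x := by
  refine Real.rpow_le_rpow (by positivity) ?_ (by positivity)
  have h := hx.sum_le_tsum (Finset.range 2) fun i _ => Real.rpow_nonneg (norm_nonneg (x i)) p
  rwa [Finset.sum_range_succ, Finset.sum_range_one] at h

/-! ### Functionals in an operator ideal -/

namespace BanachOperatorIdeal

variable {𝕜 : Type u} [RCLike 𝕜] (I : BanachOperatorIdeal 𝕜)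
  {E : Type u} [NormedAddCommGroup E] [NormedSpace 𝕜 E] [CompleteSpace E]

theorem mem_comp_scalar (φ : E →L[𝕜] 𝕜) : φ ∈ I.comp E 𝕜 :=
  I.mem_of_finiteRank E 𝕜 φ inferInstance

/-- The ideal norm of a functional is its norm. -/
theorem nrm_scalar (φ : E →L[𝕜] 𝕜) : I.nrm E 𝕜 φ = ‖φ‖ := by
  have hid := I.mem_comp_scalar (ContinuousLinearMap.id 𝕜 𝕜)
  refine le_antisymm ?_ (φ.opNorm_le_bound
    ((I.isBanachNorm E 𝕜).nonneg φ (I.mem_comp_scalar φ)) fun x => ?_)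
  · have h := I.nrm_comp_le E 𝕜 𝕜 𝕜 (ContinuousLinearMap.id 𝕜 𝕜) (ContinuousLinearMap.id 𝕜 𝕜) φ hid
    simpa [I.nrm_id] using h
  -- Restricted to the line spanned by `x`, `φ` is the multiple `φ x` of the identity, whose ideal
  -- norm is `‖φ x‖`.
  · have h := I.nrm_comp_le 𝕜 E 𝕜 𝕜 (ContinuousLinearMap.id 𝕜 𝕜) φ
      (ContinuousLinearMap.toSpanSingleton 𝕜 x) (I.mem_comp_scalar φ)
    have heq : ((ContinuousLinearMap.id 𝕜 𝕜).comp φ).comp (ContinuousLinearMap.toSpanSingleton 𝕜 x)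
        = φ x • ContinuousLinearMap.id 𝕜 𝕜 := by
      ext
      simp
    rw [heq, (I.isBanachNorm 𝕜 𝕜).smul _ _ hid, I.nrm_id] at h
    simpa using h

end BanachOperatorIdeal

/-! ### The test operators on `Λ` -/

namespace BanachSequenceSpace

variable {𝕜 : Type u} [RCLike 𝕜] (Λ : BanachSequenceSpace 𝕜)

/-- The `j`-th coordinate functional. -/
noncomputable def coord (j : ℕ) : Λ.Carrier →L[𝕜] 𝕜 :=
  LinearMap.mkContinuous
    { toFun := fun x => x.1 j
      map_add' := fun _ _ => rfl
      map_smul' := fun _ _ => rfl } 1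
    fun x => (Λ.norm_apply_le x.1 x.2 j).trans_eq (one_mul _).symm

theorem coord_e (i j : ℕ) : Λ.coord i (Λ.e j) = if i = j then 1 else 0 :=
  Pi.single_apply j (1 : 𝕜) i

/-- The operator `x ↦ (x₀ + x₁) e₀ + (x₀ - x₁) e₁`. -/
noncomputable def butterfly : Λ.Carrier →L[𝕜] Λ.Carrier :=
  (Λ.coord 0 + Λ.coord 1).smulRight (Λ.e 0) + (Λ.coord 0 - Λ.coord 1).smulRight (Λ.e 1)

theorem butterfly_e_zero : Λ.butterfly (Λ.e 0) = Λ.e 0 + Λ.e 1 := by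
  simp [butterfly, coord_e]

theorem butterfly_e_one : Λ.butterfly (Λ.e 1) = Λ.e 0 - Λ.e 1 := by
  simp [butterfly, coord_e, sub_eq_add_neg]

theorem butterfly_e_of_two_le {j : ℕ} (hj : 2 ≤ j) : Λ.butterfly (Λ.e j) = 0 := by
  have h0 : 0 ≠ j := by omega
  have h1 : 1 ≠ j := by omega
  simp [butterfly, coord_e, h0, h1]

/-- The projection onto the first two coordinates, with values in the two-dimensional `ℓ_1`. -/
noncomputable def firstTwo : Λ.Carrier →L[𝕜] PiLp 1 (fun _ : Fin 2 => 𝕜) :=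
  (PiLp.continuousLinearEquiv 1 𝕜 (fun _ : Fin 2 => 𝕜)).symm.toContinuousLinearMap.comp
    (ContinuousLinearMap.pi ![Λ.coord 0, Λ.coord 1])

theorem norm_firstTwo (x : Λ.Carrier) : ‖Λ.firstTwo x‖ = ‖Λ.coord 0 x‖ + ‖Λ.coord 1 x‖ := by
  rw [PiLp.norm_eq_of_L1, Fin.sum_univ_two]
  rfl

end BanachSequenceSpace

/-! ### The two contradictory estimates -/

theorem SequenceClass.RepresentedBy.norm_butterfly_le {𝕜 : Type u} [RCLike 𝕜] {p : ℝ}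
    (hp : 1 ≤ p) {I : BanachOperatorIdeal 𝕜} {Λ : ScalarSequenceSpace 𝕜}
    (h : (absSummableClass 𝕜 hp).RepresentedBy I Λ) {C : ℝ} (hC : 0 ≤ C)
    (hle : ∀ a b : 𝕜, ‖a + b‖ ^ p + ‖a - b‖ ^ p ≤ C ^ p * (‖a‖ ^ p + ‖b‖ ^ p)) :
    ‖Λ.butterfly‖ ≤ C := by
  have hp0 : 0 < p := by linarith
  have hnorm : ∀ φ : Λ.Carrier →L[𝕜] 𝕜, ‖φ‖ = absSummableNorm p 𝕜 fun j => φ (Λ.e j) :=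
    fun φ => (I.nrm_scalar φ).symm.trans ((h 𝕜).2 φ (I.mem_comp_scalar φ)).symm
  have hdual : ∀ φ : Λ.Carrier →L[𝕜] 𝕜, ‖φ.comp Λ.butterfly‖ ≤ C * ‖φ‖ := by
    intro φ
    have hsum : Summable fun j => ‖φ (Λ.e j)‖ ^ p := (h 𝕜).1.mapsTo (I.mem_comp_scalar φ)
    -- The pulled-back functional vanishes on `e_j` for `j ≥ 2`, so its norm is explicit; for `φ`
    -- itself a lower bound by two coordinates suffices.
    rw [hnorm, hnorm, absSummableNorm_eq_of_two_le hp0 _ fun j hj => by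
      simp [Λ.butterfly_e_of_two_le hj]]
    simp only [ContinuousLinearMap.comp_apply, Λ.butterfly_e_zero, Λ.butterfly_e_one, map_add,
      map_sub]
    calc _ ≤ (C ^ p * (‖φ (Λ.e 0)‖ ^ p + ‖φ (Λ.e 1)‖ ^ p)) ^ (1 / p) :=
          Real.rpow_le_rpow (by positivity) (hle _ _) (by positivity)
      _ = C * (‖φ (Λ.e 0)‖ ^ p + ‖φ (Λ.e 1)‖ ^ p) ^ (1 / p) := by
          rw [Real.mul_rpow (by positivity) (by positivity), ← Real.rpow_mul hC,
            mul_one_div_cancel hp0.ne', Real.rpow_one]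
      _ ≤ _ := mul_le_mul_of_nonneg_left (le_absSummableNorm hp0 _ hsum) hC
  refine ContinuousLinearMap.opNorm_le_bound _ hC fun x => ?_
  -- By Hahn–Banach, the bound on the adjoint passes to the operator.
  refine NormedSpace.norm_le_dual_bound 𝕜 _ (by positivity) fun φ => ?_
  calc ‖φ (Λ.butterfly x)‖ ≤ ‖φ.comp Λ.butterfly‖ * ‖x‖ :=
        (φ.comp Λ.butterfly).le_opNorm x
    _ ≤ C * ‖φ‖ * ‖x‖ := by gcongr; exact hdual φ
    _ = C * ‖x‖ * ‖φ‖ := by ring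

theorem SequenceClass.RepresentedBy.two_le_norm_butterfly {𝕜 : Type u} [RCLike 𝕜] {p : ℝ}
    (hp : 1 ≤ p) {I : BanachOperatorIdeal 𝕜} {Λ : ScalarSequenceSpace 𝕜}
    (h : (absSummableClass 𝕜 hp).RepresentedBy I Λ) : 2 ≤ ‖Λ.butterfly‖ := by
  have hp0 : 0 < p := by linarith
  let E := PiLp 1 (fun _ : Fin 2 => 𝕜)
  have hmem : Λ.firstTwo ∈ I.comp Λ.Carrier E := I.mem_of_finiteRank _ _ _ inferInstance
  have hnrm := (h E).2 _ hmem
  have hmem' := I.comp_mem _ _ _ _ (ContinuousLinearMap.id 𝕜 E) _ Λ.butterfly hmem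
  have hnrm' := (h E).2 _ hmem'
  have hle := I.nrm_comp_le _ _ _ _ (ContinuousLinearMap.id 𝕜 E) _ Λ.butterfly hmem
  rw [← hnrm, ← hnrm'] at hle
  change absSummableNorm p E _ ≤ _ * absSummableNorm p E _ * _ at hle
  have hzero : ∀ j, 2 ≤ j → Λ.firstTwo (Λ.e j) = 0 := fun j hj => by
    have h0 : 0 ≠ j := by omega
    have h1 : 1 ≠ j := by omega
    rw [← norm_eq_zero, Λ.norm_firstTwo]
    simp [Λ.coord_e, h0, h1]
  rw [absSummableNorm_eq_of_two_le hp0 _ hzero, absSummableNorm_eq_of_two_le hp0 _ fun j hj => by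
      simp [Λ.butterfly_e_of_two_le hj]] at hle
  simp only [ContinuousLinearMap.comp_apply, ContinuousLinearMap.id_apply, Λ.butterfly_e_zero,
    Λ.butterfly_e_one, Λ.norm_firstTwo] at hle
  -- What remains is `(2^p + 2^p)^{1/p} ≤ 2^{1/p} ‖B‖`.
  norm_num [Λ.coord_e] at hle
  have h2 : ((2 : ℝ) ^ p + 2 ^ p) ^ p⁻¹ = 2 * 2 ^ p⁻¹ := by
    rw [← two_mul, mul_comm, Real.mul_rpow (by positivity) (by norm_num),
      ← Real.rpow_mul (by norm_num), mul_inv_cancel₀ hp0.ne', Real.rpow_one]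
  rw [h2, mul_comm] at hle
  exact le_of_mul_le_mul_left hle (by positivity)

theorem mainTheorem2 {𝕜 : Type u} [RCLike 𝕜] (p : ℝ) (hp : 1 < p) :
    ¬ (absSummableClass 𝕜 hp.le).IdealRepresentable := by
  rintro ⟨I, Λ, h⟩
  obtain ⟨C, hC, hC2, hle⟩ := exists_rpow_norm_add_add_rpow_norm_sub_le (𝕜 := 𝕜) hp
  exact absurd (h.two_le_norm_butterfly hp.le)
    (not_le.2 ((h.norm_butterfly_le hp.le hC hle).trans_lt hC2))
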